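/- Let $\mathbb{E}$ and $\mathbb{E}'$ be locally compact Hausdorff spaces with countable bases, equipped with Radon measures $\lambda$ and $\lambda'$ (Borel measures that are finite on compact sets). Call a Borel set bounded if it is relatively compact. Let $A_1,\dots,A_N\subset\mathbb{E}$ be pairwise disjoint bounded Borel sets with $\lambda(A_i)>0$, let $B_1,\dots,B_N\subset\mathbb{E}'$ be pairwise disjoint bounded Borel sets with $\lambda'(B_i)>0$, and put $A=\bigcup_{i=1}^N A_i$, $B=\bigcup_{i=1}^N B_i$. Let $0<\alpha_n<1$ for $1\le n\le M$, let $f_1,\dots,f_M:\mathbb{E}\to\mathbb{C}$ be continuous functions that are orthonormal in $L^2(A,\lambda)$, and let $g_1,\dots,g_M:\mathbb{E}'\to\mathbb{C}$ be measurable functions that are orthonormal in $L^2(B,\lambda')$. A point process on $\mathbb{E}$ is a random subset $\psi\subset\mathbb{E}$ that has finitely many points in every bounded Borel set and whose counts $N_D(\psi)=|\psi\cap D|$, $D$ bounded Borel, are random variables. It is determinantal with kernel $K:\mathbb{E}\times\mathbb{E}\to\mathbb{C}$ (with respect to $\lambda$) if $K$ defines a self-adjoint, locally trace-class integral operator and if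 for every $k\ge1$ the intensity measure $$\mu_k(D)=\frac1{k!}\,\mathbb{E}\,\#\{(z_1,\dots,z_k)\in D:\ z_1,\dots,z_k\in\psi\text{ pairwise distinct}\},\qquad D\subset\mathbb{E}^k\text{ Borel},$$ has density $\rho_k(z)=\frac1{k!}\det\big(K(z_i,z_j)\big)_{1\le i,j\le k}$ with respect to $\lambda^k$; likewise on $\mathbb{E}'$. Let $\psi\subset\mathbb{E}$ and $\psi'\subset\mathbb{E}'$ be determinantal point processes with respective kernels $$K_A(z_1,z_2)=\sum_{n=1}^M\alpha_n f_n(z_1)\overline{f_n(z_2)},\qquad L_B(z_1,z_2)=\sum_{n=1}^M\alpha_n g_n(z_1)\overline{g_n(z_2)},$$ and assume that for all $1\le i\le N$ and $1\le n,m\le M$, $$\int_{A_i}f_n(z)\overline{f_m(z)}\,d\lambda(z)=\int_{B_i}g_n(z)\overline{g_m(z)}\,d\lambda'(z).$$ Then for all nonnegative integers $k_1,\dots,k_N$, $$P\{N_{A_i}(\psi)=k_i\ \text{for all } 1\le i\le N\}=P\{N_{B_i}(\psi')=k_i\ \text{for all } 1\le i\le N\}.$$ -/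

import Mathlib

open MeasureTheory
open scoped NNReal ENNReal ComplexConjugate

noncomputable section

/-- A bounded Borel set: Borel and relatively compact. -/
def IsBoundedBorel {E : Type*} [TopologicalSpace E] [MeasurableSpace E] (A : Set E) : Prop :=
  MeasurableSet A ∧ IsCompact (closure A)

/-- `N_A(ψ)`, the number of points of the configuration `S ⊆ E` lying in `A`. -/
def pointCount {E : Type*} (S A : Set E) : ℕ∞ := (S ∩ A).encard

/-- A (simple) point process on `E` defined on `Ω`: a random subset `ψ ω` of `E` with finitely many
points in every bounded Borel set, whose counts in bounded Borel sets are random variables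
(that is, `ω ↦ ∑_{z ∈ ψ ω} δ_z` is measurable for the usual σ-algebra on counting measures). -/
structure IsPointProcess {Ω E : Type*} [MeasurableSpace Ω] [TopologicalSpace E] [MeasurableSpace E]
    (ψ : Ω → Set E) : Prop where
  finite_inter : ∀ ω, ∀ A : Set E, IsBoundedBorel A → (ψ ω ∩ A).Finite
  measurable_count : ∀ A : Set E, IsBoundedBorel A → Measurable fun ω => pointCount (ψ ω) A

/-- The ordered `k`-tuples of pairwise distinct points of the configuration `S`. Summing `1_D` over
this set is the same as summing `1_D(z_{σ(1)}, …, z_{σ(k)})` over all `k`-point subsets of `S` and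
all permutations `σ`. -/
def orderedTuples {E : Type*} (S : Set E) (k : ℕ) : Set (Fin k → E) :=
  {z | Function.Injective z ∧ ∀ i, z i ∈ S}

/-- The intensity measure of order `k` of the process `ψ` under `P`, evaluated at `D ⊆ E^k`:
`μ_k(D) = (1 / k!) 𝔼 #{ordered k-tuples of distinct points of ψ lying in D}`. -/
def intensity {Ω E : Type*} [MeasurableSpace Ω] (P : Measure Ω) (ψ : Ω → Set E) (k : ℕ)
    (D : Set (Fin k → E)) : ℝ≥0∞ :=
  ((k.factorial : ℕ) : ℝ≥0∞)⁻¹ *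
    ∫⁻ ω, (((orderedTuples (ψ ω) k ∩ D).encard : ℕ∞) : ℝ≥0∞) ∂P

/-- `T` is the integral operator `K_A` on `L²(A, lam)` with kernel `K`. -/
def IsIntegralOperatorOn {E : Type*} [MeasurableSpace E] (lam : Measure E) (K : E → E → ℂ)
    (A : Set E) (T : Lp ℂ 2 (lam.restrict A) →L[ℂ] Lp ℂ 2 (lam.restrict A)) : Prop :=
  ∀ h : Lp ℂ 2 (lam.restrict A),
    (∀ᵐ x ∂(lam.restrict A), Integrable (fun y => K x y * h y) (lam.restrict A)) ∧
    T h =ᵐ[lam.restrict A] fun x => ∫ y in A, K x y * h y ∂lam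

/-- Trace-class (equivalently, nuclear) operators on a complex Hilbert space: absolutely convergent
sums of rank-one operators `v ↦ ⟪x n, v⟫ y n`. -/
def IsTraceClassOp {H : Type*} [NormedAddCommGroup H] [InnerProductSpace ℂ H]
    (T : H →L[ℂ] H) : Prop :=
  ∃ x y : ℕ → H, Summable (fun n => ‖x n‖ * ‖y n‖) ∧
    ∀ v : H, HasSum (fun n => (inner ℂ (x n) v : ℂ) • y n) (T v)

/-- `K` defines a self-adjoint, locally trace-class operator: on every bounded Borel set `A` it
induces a self-adjoint trace-class integral operator `K_A` of `L²(A, lam)`. -/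
def IsLocallyTraceClassKernel {E : Type*} [TopologicalSpace E] [MeasurableSpace E]
    (lam : Measure E) (K : E → E → ℂ) : Prop :=
  Measurable (Function.uncurry K) ∧
  ∀ A : Set E, IsBoundedBorel A →
    ∃ T : Lp ℂ 2 (lam.restrict A) →L[ℂ] Lp ℂ 2 (lam.restrict A),
      IsIntegralOperatorOn lam K A T ∧ IsSelfAdjoint T ∧ IsTraceClassOp T

/-- Under `P`, `ψ` is a determinantal point process on `E` with kernel `K` with respect to the
reference measure `lam`: `K` defines a self-adjoint, locally trace-class operator, and for every
`k ≥ 1` the intensity measure of order `k` has the density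
`ρ_k(z) = (1 / k!) det (K(z_i, z_j))` with respect to the product measure `lam^k`. -/
structure IsDeterminantal {Ω E : Type*} [MeasurableSpace Ω] [TopologicalSpace E]
    [MeasurableSpace E] (P : Measure Ω) (ψ : Ω → Set E) (lam : Measure E)
    (K : E → E → ℂ) : Prop where
  isPointProcess : IsPointProcess ψ
  kernel : IsLocallyTraceClassKernel lam K
  correlation : ∀ k : ℕ, 1 ≤ k → ∃ ρ : (Fin k → E) → ℝ≥0, Measurable ρ ∧
    (∀ D : Set (Fin k → E), MeasurableSet D →
      intensity P ψ k D = ∫⁻ z in D, (ρ z : ℝ≥0∞) ∂(Measure.pi fun _ : Fin k => lam)) ∧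
    ∀ z : Fin k → E, ((ρ z : ℝ) : ℂ) =
      (1 / (k.factorial : ℂ)) * (Matrix.of fun i j : Fin k => K (z i) (z j)).det

/-- The finite-rank kernel `∑ₙ αₙ fₙ(z₁) conj (fₙ(z₂))`. -/
def finiteRankKernel {E : Type*} {M : ℕ} (α : Fin M → ℝ) (f : Fin M → E → ℂ) (z₁ z₂ : E) : ℂ :=
  ∑ n : Fin M, (α n : ℂ) * f n z₁ * conj (f n z₂)

/-- The functions `fₙ` are orthonormal on `A`, that is, in `L²(A, lam)`. -/
def IsOrthonormalOn {E : Type*} [MeasurableSpace E] {M : ℕ} (lam : Measure E) (A : Set E)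
    (f : Fin M → E → ℂ) : Prop :=
  (∀ n, MemLp (f n) 2 (lam.restrict A)) ∧
    ∀ n m, ∫ z in A, f n z * conj (f m z) ∂lam = if n = m then 1 else 0

end

/-! The joint law of the counts is determined by finitely many factorial moments, and these depend
only on `α` and the local Gram matrices. For a colouring `c` of the indices, the expected number of
tuples of distinct points with `z j ∈ A (c j)` is a joint factorial moment of the counts, and also
the integral of the correlation determinant over a product set. Expanding that determinant and
applying Fubini leaves products of Gram entries on the `A i`, which agree for both processes
(`IsDeterminantal.lintegral_prod_descFactorial`). The kernel has rank at most `M`, so counts are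
almost surely at most `M` (`IsDeterminantal.ae_ncard_le`), and on `{0, …, M}` the indicator of a
value is a combination of falling factorials. -/

/-! ### Tuples of distinct points and falling factorials -/

/-- Embeddings along the fibres of `c` are the injective choices `z` with `z j ∈ A (c j)`. -/
def orderedTuplesInterPiEquiv {E : Type*} (S : Set E) {N k : ℕ} (A : Fin N → Set E)
    (hA : Pairwise fun i j => Disjoint (A i) (A j)) (c : Fin k → Fin N) :
    ↥(orderedTuples S k ∩ Set.univ.pi fun j => A (c j)) ≃
      ((i : Fin N) → ({j // c j = i} ↪ ↥(S ∩ A i))) where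
  toFun z i :=
    ⟨fun j => ⟨z.1 j.1, z.2.1.2 j.1, (congrArg A j.2).subset (z.2.2 j.1 trivial)⟩, fun j j' h =>
      Subtype.ext (z.2.1.1 (congrArg Subtype.val h))⟩
  invFun e := ⟨fun j => (e (c j) ⟨j, rfl⟩).1, by
    refine ⟨⟨fun j j' h => ?_, fun j => (e (c j) ⟨j, rfl⟩).2.1⟩,
      fun j _ => (e (c j) ⟨j, rfl⟩).2.2⟩
    -- A free colour `i` lets `c j' = i` be eliminated by substitution despite the dependent type of
    -- `e`.
    have key : ∀ i (j' : Fin k) (hj' : c j' = i) (x : {j // c j = i}),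
        (e i x).1 = (e (c j') ⟨j', rfl⟩).1 → x.1 = j' := by
      rintro i j' rfl x hx
      exact congrArg Subtype.val ((e (c j')).injective (Subtype.ext hx))
    have hc : c j' = c j := by
      by_contra hne
      refine Set.disjoint_left.1 (hA hne) (e (c j') ⟨j', rfl⟩).2.2 ?_
      have := (e (c j) ⟨j, rfl⟩).2.2
      simp only at h
      rwa [h] at this
    exact key (c j) j' hc ⟨j, rfl⟩ h⟩
  left_inv z := rfl
  right_inv e := by
    funext i
    ext ⟨j, rfl⟩
    rfl

theorem encard_orderedTuples_inter_pi {E : Type*} (S : Set E) {N k : ℕ} (A : Fin N → Set E)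
    (hA : Pairwise fun i j => Disjoint (A i) (A j)) (hS : ∀ i, (S ∩ A i).Finite)
    (c : Fin k → Fin N) :
    (orderedTuples S k ∩ Set.univ.pi fun j => A (c j)).encard =
      ((∏ i, (S ∩ A i).ncard.descFactorial (Fintype.card {j // c j = i}) : ℕ) : ℕ∞) := by
  classical
  have : ∀ i, Fintype ↥(S ∩ A i) := fun i => (hS i).fintype
  rw [← ENat.card_coe_set_eq, ENat.card_congr (orderedTuplesInterPiEquiv S A hA c),
    ENat.card_eq_coe_fintype_card, Fintype.card_pi]
  congr 1
  refine Finset.prod_congr rfl fun i _ => ?_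
  rw [Fintype.card_embedding_eq, ← Nat.card_eq_fintype_card, Nat.card_coe_set_eq]

/-! ### Bounded counts are determined by factorial moments -/

/-- Triangular inversion, by descending induction on `k`: `x.choose k` vanishes below `k` and is 1
at `k`; its values at `k < j ≤ L` are removed using the indicators already obtained. -/
theorem exists_indicator_eq_sum_descFactorial (L k : ℕ) :
    ∃ a : ℕ → ℝ, ∀ x ≤ L, (if x = k then (1 : ℝ) else 0) =
      ∑ m ∈ Finset.range (L + 1), a m * (x.descFactorial m : ℝ) := by
  induction hd : L + 1 - k using Nat.strong_induction_on generalizing k with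
  | _ d ih =>
    by_cases hk : L < k
    · exact ⟨0, fun x hx => by simp [show x ≠ k by omega]⟩
    -- The condition `k < j` sits inside the existential so that `choose` yields coefficients for
    -- every `j`.
    have ih' : ∀ j, ∃ a : ℕ → ℝ, k < j → ∀ x ≤ L, (if x = j then (1 : ℝ) else 0) =
        ∑ m ∈ Finset.range (L + 1), a m * (x.descFactorial m : ℝ) := fun j => by
      by_cases hj : k < j
      · obtain ⟨a, ha⟩ := ih (L + 1 - j) (by omega) j rfl
        exact ⟨a, fun _ => ha⟩
      · exact ⟨0, fun h => absurd h hj⟩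
    choose a ha using ih'
    refine ⟨fun m => (if m = k then ((k.factorial : ℝ))⁻¹ else 0) -
      ∑ j ∈ Finset.Ioc k L, (j.choose k : ℝ) * a j m, fun x hx => ?_⟩
    have h1 : ∑ m ∈ Finset.range (L + 1), ((if m = k then ((k.factorial : ℝ))⁻¹ else 0) -
        ∑ j ∈ Finset.Ioc k L, (j.choose k : ℝ) * a j m) * (x.descFactorial m : ℝ) =
        (x.choose k : ℝ) - ∑ j ∈ Finset.Ioc k L, (j.choose k : ℝ) * if x = j then 1 else 0 := by
      simp_rw [sub_mul, Finset.sum_sub_distrib]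
      congr 1
      · simp only [ite_mul, zero_mul, Finset.sum_ite_eq', Finset.mem_range]
        rw [if_pos (by omega), Nat.descFactorial_eq_factorial_mul_choose]
        push_cast
        field_simp
      · simp_rw [Finset.sum_mul]
        rw [Finset.sum_comm]
        refine Finset.sum_congr rfl fun j hj => ?_
        rw [ha j (Finset.mem_Ioc.1 hj).1 x hx, Finset.mul_sum]
        exact Finset.sum_congr rfl fun m _ => mul_assoc _ _ _
    rw [h1]
    simp only [mul_ite, mul_one, mul_zero, Finset.sum_ite_eq, Finset.mem_Ioc]
    rcases lt_trichotomy x k with h | h | h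
    · simp [Nat.choose_eq_zero_of_lt h, h.ne]
    · simp [h]
    · simp [h, h.ne', hx]

theorem measure_eq_sum_factorial_moments {Ω : Type*} [MeasurableSpace Ω]
    (P : Measure Ω) [IsProbabilityMeasure P] {N L : ℕ} (X : Ω → Fin N → ℕ) (hX : Measurable X)
    (hL : ∀ᵐ ω ∂P, ∀ i, X ω i ≤ L) (k : Fin N → ℕ) (a : Fin N → ℕ → ℝ)
    (ha : ∀ i, ∀ x ≤ L, (if x = k i then (1 : ℝ) else 0) =
      ∑ m ∈ Finset.range (L + 1), a i m * (x.descFactorial m : ℝ)) :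
    P.real {ω | ∀ i, X ω i = k i} =
      ∑ m ∈ Fintype.piFinset fun _ : Fin N => Finset.range (L + 1), (∏ i, a i (m i)) *
        (∫⁻ ω, ((∏ i, (X ω i).descFactorial (m i) : ℕ) : ℝ≥0∞) ∂P).toReal := by
  have hmeas : ∀ m : Fin N → ℕ, Measurable fun ω => ∏ i, (X ω i).descFactorial (m i) :=
    fun m => (measurable_of_countable fun x : Fin N → ℕ => ∏ i, (x i).descFactorial (m i)).comp hX
  have hint : ∀ m : Fin N → ℕ,
      Integrable (fun ω => ((∏ i, (X ω i).descFactorial (m i) : ℕ) : ℝ)) P := by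
    intro m
    refine Integrable.of_bound
      ((measurable_of_countable fun n : ℕ => (n : ℝ)).comp (hmeas m)).aestronglyMeasurable
      ((∏ i, L ^ m i : ℕ) : ℝ) ?_
    filter_upwards [hL] with ω hω
    rw [Real.norm_natCast]
    exact_mod_cast Finset.prod_le_prod' fun i _ =>
      (Nat.descFactorial_le_pow _ _).trans (Nat.pow_le_pow_left (hω i) _)
  have hset : MeasurableSet {ω | ∀ i, X ω i = k i} := by
    have : {ω | ∀ i, X ω i = k i} = X ⁻¹' {k} := by ext ω; simp [funext_iff]
    exact this ▸ hX (measurableSet_singleton k)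
  have hmom : ∀ m : Fin N → ℕ,
      (∫⁻ ω, ((∏ i, (X ω i).descFactorial (m i) : ℕ) : ℝ≥0∞) ∂P).toReal =
        ∫ ω, ((∏ i, (X ω i).descFactorial (m i) : ℕ) : ℝ) ∂P := by
    intro m
    rw [integral_eq_lintegral_of_nonneg_ae (Filter.Eventually.of_forall fun ω => by positivity)
      (hint m).aestronglyMeasurable]
    simp_rw [ENNReal.ofReal_natCast]
  simp_rw [hmom, ← integral_const_mul]
  rw [← integral_finsetSum _ fun m _ => (hint m).const_mul _, ← integral_indicator_one hset]
  refine integral_congr_ae ?_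
  filter_upwards [hL] with ω hω
  have h1 : Set.indicator {ω | ∀ i, X ω i = k i} (1 : Ω → ℝ) ω =
      ∏ i, if X ω i = k i then (1 : ℝ) else 0 := by
    rw [Finset.prod_ite_zero]
    simp [Set.indicator_apply]
  rw [h1, Finset.prod_congr rfl fun i _ => ha i _ (hω i), Finset.prod_univ_sum]
  refine Finset.sum_congr rfl fun m _ => ?_
  rw [Finset.prod_mul_distrib]
  push_cast
  rfl

/-! ### Determinants of the finite-rank kernel -/

/-- In the Leibniz formula `z j` enters as first argument of the factor `σ.symm j` and as second
argument of the factor `j`; grouping by `z j` prepares Fubini. -/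
theorem det_finiteRankKernel {E : Type*} {M k : ℕ} (α : Fin M → ℝ) (f : Fin M → E → ℂ)
    (z : Fin k → E) :
    (Matrix.of fun i j : Fin k => finiteRankKernel α f (z i) (z j)).det =
      ∑ σ : Equiv.Perm (Fin k), ∑ n : Fin k → Fin M,
        (((Equiv.Perm.sign σ : ℤ) : ℂ) * ∏ i, (α (n i) : ℂ)) *
          ∏ j, (f (n (σ.symm j)) (z j) * conj (f (n j) (z j))) := by
  rw [Matrix.det_apply']
  refine Finset.sum_congr rfl fun σ _ => ?_
  simp only [Matrix.of_apply, finiteRankKernel]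
  rw [Finset.prod_univ_sum, Fintype.piFinset_univ, Finset.mul_sum]
  refine Finset.sum_congr rfl fun n _ => ?_
  rw [mul_assoc, Finset.prod_mul_distrib, Finset.prod_mul_distrib, Finset.prod_mul_distrib,
    mul_assoc]
  congr 3
  rw [← Equiv.prod_comp σ fun j => f (n (σ.symm j)) (z j)]
  simp

/-- The matrix factors through dimension `M < k`. -/
theorem det_finiteRankKernel_eq_zero {E : Type*} {M k : ℕ} (hk : M < k) (α : Fin M → ℝ)
    (f : Fin M → E → ℂ) (z : Fin k → E) :
    (Matrix.of fun i j : Fin k => finiteRankKernel α f (z i) (z j)).det = 0 := by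
  by_contra h
  have h1 := Matrix.rank_of_det_ne_zero h
  have h2 : (Matrix.of fun i j : Fin k => finiteRankKernel α f (z i) (z j)) =
      (Matrix.of fun (i : Fin k) (n : Fin M) => (α n : ℂ) * f n (z i)) *
        Matrix.of fun (n : Fin M) (j : Fin k) => conj (f n (z j)) := by
    ext i j
    simp [Matrix.mul_apply, finiteRankKernel]
  rw [h2] at h1
  have h3 := (Matrix.rank_mul_le_left (Matrix.of fun (i : Fin k) (n : Fin M) => (α n : ℂ) * f n (z i))
    (Matrix.of fun (n : Fin M) (j : Fin k) => conj (f n (z j)))).trans (Matrix.rank_le_width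
    (Matrix.of fun (i : Fin k) (n : Fin M) => (α n : ℂ) * f n (z i)))
  rw [h1, Fintype.card_fin] at h3
  omega

theorem setIntegral_pi_det_finiteRankKernel {E : Type*} [MeasurableSpace E] (lam : Measure E)
    [SigmaFinite lam] {N M k : ℕ} (A : Fin N → Set E) (α : Fin M → ℝ) (f : Fin M → E → ℂ)
    (hf : ∀ i n m, Integrable (fun z => f n z * conj (f m z)) (lam.restrict (A i)))
    (c : Fin k → Fin N) :
    Integrable (fun z : Fin k → E =>
        (Matrix.of fun i j : Fin k => finiteRankKernel α f (z i) (z j)).det)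
      ((Measure.pi fun _ => lam).restrict (Set.univ.pi fun j => A (c j))) ∧
    ∫ z in Set.univ.pi fun j => A (c j),
        (Matrix.of fun i j : Fin k => finiteRankKernel α f (z i) (z j)).det
          ∂(Measure.pi fun _ => lam) =
      ∑ σ : Equiv.Perm (Fin k), ∑ n : Fin k → Fin M,
        (((Equiv.Perm.sign σ : ℤ) : ℂ) * ∏ i, (α (n i) : ℂ)) *
          ∏ j, ∫ z in A (c j), f (n (σ.symm j)) z * conj (f (n j) z) ∂lam := by
  simp_rw [det_finiteRankKernel, Measure.restrict_pi_pi]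
  have hint : ∀ (σ : Equiv.Perm (Fin k)) (n : Fin k → Fin M), Integrable (fun z : Fin k → E =>
      (((Equiv.Perm.sign σ : ℤ) : ℂ) * ∏ i, (α (n i) : ℂ)) *
        ∏ j, (f (n (σ.symm j)) (z j) * conj (f (n j) (z j))))
      (Measure.pi fun j => lam.restrict (A (c j))) := fun σ n =>
    (Integrable.fintype_prod fun j => hf (c j) (n (σ.symm j)) (n j)).const_mul _
  refine ⟨integrable_finsetSum _ fun σ _ => integrable_finsetSum _ fun n _ => hint σ n, ?_⟩
  rw [integral_finsetSum _ fun σ _ => integrable_finsetSum _ fun n _ => hint σ n]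
  refine Finset.sum_congr rfl fun σ _ => ?_
  rw [integral_finsetSum _ fun n _ => hint σ n]
  refine Finset.sum_congr rfl fun n _ => ?_
  rw [integral_const_mul, integral_fintype_prod_eq_prod
    (f := fun j z => f (n (σ.symm j)) z * conj (f (n j) z))]

theorem toENNReal_encard_orderedTuples {E : Type*} (S : Set E) {N k : ℕ} (A : Fin N → Set E)
    (hA : Pairwise fun i j => Disjoint (A i) (A j)) (hS : ∀ i, (S ∩ A i).Finite)
    (c : Fin k → Fin N) :
    (((orderedTuples S k ∩ Set.univ.pi fun j => A (c j)).encard : ℕ∞) : ℝ≥0∞) =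
      ((∏ i, (S ∩ A i).ncard.descFactorial (Fintype.card {j // c j = i}) : ℕ) : ℝ≥0∞) := by
  rw [encard_orderedTuples_inter_pi S A hA hS c, ENat.toENNReal_coe]

theorem IsPointProcess.measurable_ncard {Ω E : Type*} [MeasurableSpace Ω] [TopologicalSpace E]
    [MeasurableSpace E] {ψ : Ω → Set E} (hψ : IsPointProcess ψ) {A : Set E}
    (hA : IsBoundedBorel A) : Measurable fun ω => (ψ ω ∩ A).ncard :=
  (measurable_of_countable ENat.toNat).comp (hψ.measurable_count A hA)

/-! ### Factorial moments and almost sure bounds -/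

section Determinantal

variable {Ω E : Type*} [MeasurableSpace Ω] {P : Measure Ω} [TopologicalSpace E]
  [MeasurableSpace E] {lam : Measure E} {ψ : Ω → Set E} {N M : ℕ} {A : Fin N → Set E}
  {α : Fin M → ℝ} {f : Fin M → E → ℂ}

theorem IsDeterminantal.lintegral_prod_descFactorial [SigmaFinite lam]
    (hψ : IsDeterminantal P ψ lam (finiteRankKernel α f)) (hA : ∀ i, IsBoundedBorel (A i))
    (hAdisj : Pairwise fun i j => Disjoint (A i) (A j))
    (hf : ∀ i n m, Integrable (fun z => f n z * conj (f m z)) (lam.restrict (A i)))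
    {k : ℕ} (hk : 1 ≤ k) (c : Fin k → Fin N) :
    ((k.factorial : ℕ) : ℝ≥0∞)⁻¹ * ∫⁻ ω, ((∏ i, (ψ ω ∩ A i).ncard.descFactorial
        (Fintype.card {j // c j = i}) : ℕ) : ℝ≥0∞) ∂P =
      ENNReal.ofReal ((1 / (k.factorial : ℂ)) *
        ∑ σ : Equiv.Perm (Fin k), ∑ n : Fin k → Fin M,
          (((Equiv.Perm.sign σ : ℤ) : ℂ) * ∏ i, (α (n i) : ℂ)) *
            ∏ j, ∫ z in A (c j), f (n (σ.symm j)) z * conj (f (n j) z) ∂lam).re := by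
  obtain ⟨ρ, hρ, hint, hdet⟩ := hψ.correlation k hk
  obtain ⟨hi, he⟩ := setIntegral_pi_det_finiteRankKernel lam A α f hf c
  have h := hint (Set.univ.pi fun j => A (c j)) (MeasurableSet.univ_pi fun j => (hA (c j)).1)
  simp_rw [intensity, toENNReal_encard_orderedTuples _ A hAdisj
    (fun i => hψ.isPointProcess.finite_inter _ _ (hA i)) c] at h
  rw [h, ← he, ← integral_const_mul]
  simp_rw [← hdet]
  have hi' := (hi.const_mul (1 / (k.factorial : ℂ))).re
  simp_rw [← hdet] at hi'
  simp only [RCLike.re_to_complex, Complex.ofReal_re] at hi'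
  rw [integral_complex_ofReal, Complex.ofReal_re, ofReal_integral_eq_lintegral_ofReal hi'
    (Filter.Eventually.of_forall fun z => (ρ z).2)]
  simp_rw [ENNReal.ofReal_coe_nnreal]

theorem IsDeterminantal.ae_ncard_le [SigmaFinite lam]
    (hψ : IsDeterminantal P ψ lam (finiteRankKernel α f)) {D : Set E} (hD : IsBoundedBorel D) :
    ∀ᵐ ω ∂P, (ψ ω ∩ D).ncard ≤ M := by
  obtain ⟨ρ, hρ, hint, hdet⟩ := hψ.correlation (M + 1) (by omega)
  have h := hint (Set.univ.pi fun _ => D) (MeasurableSet.univ_pi fun _ => hD.1)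
  -- With a single colour, the count of tuples is the falling factorial of order `M + 1`, which
  -- vanishes exactly when there are at most `M` points.
  simp_rw [intensity, toENNReal_encard_orderedTuples _ (fun _ : Fin 1 => D)
    (fun i j hij => absurd (Subsingleton.elim i j) hij)
    (fun _ => hψ.isPointProcess.finite_inter _ _ hD) (fun _ => 0)] at h
  have hρ0 : ∀ z, ρ z = 0 := fun z => by
    have := hdet z
    rw [det_finiteRankKernel_eq_zero (Nat.lt_succ_self M), mul_zero] at this
    exact_mod_cast this
  simp only [hρ0, ENNReal.coe_zero, lintegral_zero, mul_eq_zero, ENNReal.inv_eq_zero,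
    ENNReal.natCast_ne_top, false_or] at h
  rw [lintegral_eq_zero_iff] at h
  · filter_upwards [h] with ω hω
    simp only [Pi.zero_apply, Nat.cast_eq_zero, Finset.univ_unique, Finset.prod_singleton,
      Nat.descFactorial_eq_zero_iff_lt] at hω
    simpa [Nat.lt_succ_iff] using hω
  · exact (measurable_of_countable fun n : ℕ => ((∏ i : Fin 1, n.descFactorial
      (Fintype.card {j : Fin (M + 1) // (0 : Fin 1) = i}) : ℕ) : ℝ≥0∞)).comp
        (hψ.isPointProcess.measurable_ncard hD)

end Determinantal

theorem exists_card_fiber_eq {N : ℕ} (m : Fin N → ℕ) :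
    ∃ c : Fin (∑ i, m i) → Fin N, ∀ i, Fintype.card {j // c j = i} = m i := by
  refine ⟨fun j => (finSigmaFinEquiv.symm j).1, fun i => ?_⟩
  rw [Fintype.card_congr ((finSigmaFinEquiv.symm.subtypeEquiv fun j => Iff.rfl).trans
    (Equiv.sigmaSubtype i)), Fintype.card_fin]

theorem IsOrthonormalOn.integrable_mul_conj {E : Type*} [MeasurableSpace E] {N M : ℕ}
    {lam : Measure E} {A : Fin N → Set E} {f : Fin M → E → ℂ}
    (hf : IsOrthonormalOn lam (⋃ i, A i) f) (i : Fin N) (n m : Fin M) :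
    Integrable (fun z => f n z * conj (f m z)) (lam.restrict (A i)) :=
  ((hf.1 n).integrable_mul (hf.1 m).star).mono_measure
    (Measure.restrict_mono_set lam (Set.subset_iUnion A i))

theorem proposition12
    {E E' Ω Ω' : Type*}
    [TopologicalSpace E] [LocallyCompactSpace E] [T2Space E] [SecondCountableTopology E]
    [MeasurableSpace E] [BorelSpace E]
    [TopologicalSpace E'] [LocallyCompactSpace E'] [T2Space E'] [SecondCountableTopology E']
    [MeasurableSpace E'] [BorelSpace E']
    (lam : Measure E) [IsFiniteMeasureOnCompacts lam]
    (lam' : Measure E') [IsFiniteMeasureOnCompacts lam']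
    [MeasurableSpace Ω] (P : Measure Ω) [IsProbabilityMeasure P]
    [MeasurableSpace Ω'] (P' : Measure Ω') [IsProbabilityMeasure P']
    (N M : ℕ)
    (A : Fin N → Set E) (hA : ∀ i, IsBoundedBorel (A i))
    (hApos : ∀ i, 0 < lam (A i)) (hAdisj : Pairwise fun i j => Disjoint (A i) (A j))
    (B : Fin N → Set E') (hB : ∀ i, IsBoundedBorel (B i))
    (hBpos : ∀ i, 0 < lam' (B i)) (hBdisj : Pairwise fun i j => Disjoint (B i) (B j))
    (α : Fin M → ℝ) (hα : ∀ n, 0 < α n ∧ α n < 1)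
    (f : Fin M → E → ℂ) (hf : ∀ n, Continuous (f n))
    (hforth : IsOrthonormalOn lam (⋃ i, A i) f)
    (g : Fin M → E' → ℂ) (hg : ∀ n, Measurable (g n))
    (hgorth : IsOrthonormalOn lam' (⋃ i, B i) g)
    (ψ : Ω → Set E) (hψ : IsDeterminantal P ψ lam (finiteRankKernel α f))
    (ψ' : Ω' → Set E') (hψ' : IsDeterminantal P' ψ' lam' (finiteRankKernel α g))
    (hgram : ∀ (i : Fin N) (n m : Fin M),
      ∫ z in A i, f n z * conj (f m z) ∂lam = ∫ z in B i, g n z * conj (g m z) ∂lam')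
    (k : Fin N → ℕ) :
    P {ω | ∀ i, pointCount (ψ ω) (A i) = (k i : ℕ∞)} =
      P' {ω' | ∀ i, pointCount (ψ' ω') (B i) = (k i : ℕ∞)} := by
  have hcount : ∀ ω i, pointCount (ψ ω) (A i) = (k i : ℕ∞) ↔ (ψ ω ∩ A i).ncard = k i :=
    fun ω i => by
      rw [pointCount, ← (hψ.isPointProcess.finite_inter ω _ (hA i)).cast_ncard_eq, Nat.cast_inj]
  have hcount' : ∀ ω i, pointCount (ψ' ω) (B i) = (k i : ℕ∞) ↔ (ψ' ω ∩ B i).ncard = k i :=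
    fun ω i => by
      rw [pointCount, ← (hψ'.isPointProcess.finite_inter ω _ (hB i)).cast_ncard_eq, Nat.cast_inj]
  simp_rw [hcount, hcount']
  choose a ha using fun i => exists_indicator_eq_sum_descFactorial M (k i)
  have hmom : ∀ m : Fin N → ℕ,
      ∫⁻ ω, ((∏ i, (ψ ω ∩ A i).ncard.descFactorial (m i) : ℕ) : ℝ≥0∞) ∂P =
        ∫⁻ ω, ((∏ i, (ψ' ω ∩ B i).ncard.descFactorial (m i) : ℕ) : ℝ≥0∞) ∂P' := by
    intro m
    -- Correlations are given only for order at least 1; at order 0 both moments equal the total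
    -- mass 1.
    rcases Nat.eq_zero_or_pos (∑ i, m i) with h0 | hpos
    · have hm : ∀ i, m i = 0 := fun i => Finset.sum_eq_zero_iff.1 h0 i (Finset.mem_univ i)
      simp [hm]
    obtain ⟨c, hc⟩ := exists_card_fiber_eq m
    have h1 := hψ.lintegral_prod_descFactorial hA hAdisj
      (fun i => hforth.integrable_mul_conj i) hpos c
    have h2 := hψ'.lintegral_prod_descFactorial hB hBdisj
      (fun i => hgorth.integrable_mul_conj i) hpos c
    simp_rw [hgram] at h1
    rw [← h2] at h1
    simp_rw [hc] at h1
    exact (ENNReal.mul_right_inj (ENNReal.inv_ne_zero.2 (ENNReal.natCast_ne_top _))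
      (ENNReal.inv_ne_top.2 (by exact_mod_cast Nat.factorial_ne_zero _))).1 h1
  rw [← measureReal_eq_measureReal_iff,
    measure_eq_sum_factorial_moments P (fun ω i => (ψ ω ∩ A i).ncard)
      (measurable_pi_lambda _ fun i => hψ.isPointProcess.measurable_ncard (hA i))
      (ae_all_iff.2 fun i => hψ.ae_ncard_le (hA i)) k a ha,
    measure_eq_sum_factorial_moments P' (fun ω i => (ψ' ω ∩ B i).ncard)
      (measurable_pi_lambda _ fun i => hψ'.isPointProcess.measurable_ncard (hB i))
      (ae_all_iff.2 fun i => hψ'.ae_ncard_le (hB i)) k a ha]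
  simp_rw [hmom]
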